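/- **Theorem B (MA + ¬CH).** Assume Martin's Axiom (for every nonempty partially ordered set $P$ satisfying the countable chain condition and every family $\mathcal D$ of fewer than $2^{\aleph_0}$ dense subsets of $P$, there is a filter on $P$ meeting every member of $\mathcal D$) and the negation of the Continuum Hypothesis. Write $\mathbb N=\{1,2,\dots\}$ and, for each countable limit ordinal $\beta$, fix a sequence $(\alpha_n)_{n\in\mathbb N}$ of ordinals in $[0,\beta)$ that increases to $\beta$. The Schreier families $\mathrm S_\alpha$ ($\alpha<\omega_1$) of finite subsets of $\mathbb N$ are defined recursively by $$\mathrm S_0=\{\{n\}:n\in\mathbb N\},\qquad \mathrm S_{\alpha+1}=\Big\{\bigcup_{j=1}^nE_j:\ n\in\mathbb N,\ E_1,\dots,E_n\in\mathrm S_\alpha,\ n\le E_1<E_2<\dots<E_n\Big\},$$ $$\mathrm S_\beta=\{A:\ \exists n\in\mathbb N,\ n\le A\text{ and }A\in\mathrm S_{\alpha_n}\}\quad\text{for limit }\beta,$$ where $n\le A$ means $n\le\min A$ and $E<F$ means $\max E<\min F$. Let $\mathrm S_\alpha(\mathbb Z)=\{\sum_{i\in G}c_ie_i:\ G\in\mathrm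 S_\alpha,\ c_i\in\mathbb Z\}\subset c_0$, where $(e_i)_{i\in\mathbb N}$ is the canonical basis of $c_0$, and let $d_\infty$ be the metric on it induced by the norm of $c_0$. A metric space $X$ coarsely embeds into a metric space $Y$ (that is, $Y$ contains a coarse copy of $X$) if there are a map $f:X\to Y$ and non-decreasing functions $\rho,\omega:[0,\infty)\to[0,\infty)$ with $\lim_{t\to\infty}\rho(t)=\infty$ and $\rho(d_X(x,y))\le d_Y(f(x),f(y))\le\omega(d_X(x,y))$ for all $x,y\in X$. If $M$ is a separable metric space such that $(\mathrm S_\alpha(\mathbb Z),d_\infty)$ coarsely embeds into $M$ for every $\alpha<\omega_1$, then $M$ is coarsely universal for the class of all separable metric spaces: every separable metric space coarsely embeds into $M$. -/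

import Mathlib

open scoped NNReal Cardinal Ordinal ZeroAtInfty

/-! ### Coarse embeddings -/

/-- `X` `(ρ, σ)`-embeds into `Y`. -/
def ModuliEmbeds (ρ σ : ℝ≥0 → ℝ≥0) (X : Type*) (Y : Type*) [MetricSpace X] [MetricSpace Y] :
    Prop :=
  ∃ f : X → Y, ∀ x y : X,
    ρ (nndist x y) ≤ nndist (f x) (f y) ∧ nndist (f x) (f y) ≤ σ (nndist x y)

/-- `X` coarsely embeds into `Y` (equivalently, `Y` contains a coarse copy of `X`). -/
def CoarselyEmbeds (X : Type*) (Y : Type*) [MetricSpace X] [MetricSpace Y] : Prop :=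
  ∃ ρ σ : ℝ≥0 → ℝ≥0, Monotone ρ ∧ Monotone σ ∧ Filter.Tendsto ρ Filter.atTop Filter.atTop ∧
    ModuliEmbeds ρ σ X Y

universe u v

/-- `M` is coarsely universal for the class of all separable metric spaces (living in the
universe `v`). -/
def CoarselyUniversalForSeparable (M : Type u) [MetricSpace M] : Prop :=
  ∀ (X : Type v) [MetricSpace X] [TopologicalSpace.SeparableSpace X], CoarselyEmbeds X M

/-! ### Schreier families and the associated metric spaces -/

/-- A choice, for each countable limit ordinal `β`, of a sequence `(α_n)_{n ≥ 1}` of ordinals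
below `β` which increases to `β`. The values of `seq` elsewhere play no role. -/
structure LadderSystem where
  seq : Ordinal.{0} → ℕ+ → Ordinal.{0}
  seq_lt : ∀ β < ω₁, Order.IsSuccLimit β → ∀ n, seq β n < β
  monotone_seq : ∀ β < ω₁, Order.IsSuccLimit β → Monotone (seq β)
  exists_lt_seq : ∀ β < ω₁, Order.IsSuccLimit β → ∀ γ < β, ∃ n, γ < seq β n

/-- `SchreierFamily L α A` says that the finite set `A` of positive integers belongs to the
Schreier family of order `α`, built with the sequences `L` at limit ordinals. -/
inductive SchreierFamily (L : LadderSystem) : Ordinal.{0} → Finset ℕ+ → Prop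
  | zero (n : ℕ+) : SchreierFamily L 0 {n}
  | succ (α : Ordinal.{0}) (n : ℕ+) (E : Fin (n : ℕ) → Finset ℕ+)
      (mem : ∀ j, SchreierFamily L α (E j))
      (le : ∀ j, ∀ m ∈ E j, n ≤ m)
      (lt : ∀ i j, i < j → ∀ k ∈ E i, ∀ m ∈ E j, k < m) :
      SchreierFamily L (α + 1) (Finset.univ.biUnion E)
  | limit (β : Ordinal.{0}) (hβ : Order.IsSuccLimit β) (n : ℕ+) (A : Finset ℕ+)
      (le : ∀ m ∈ A, n ≤ m)
      (mem : SchreierFamily L (L.seq β n) A) :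
      SchreierFamily L β A

/-- The integer-valued Schreier space `S_α(ℤ)`: all `∑_{i ∈ G} c_i e_i` with `G` in the Schreier
family of order `α` and `c_i ∈ ℤ`. It is a subset of `c₀ = C₀(ℕ+, ℝ)` (`ℕ+` is discrete) and its
metric is the one induced by the supremum norm. -/
def SchreierSpace (L : LadderSystem) (α : Ordinal.{0}) : Set C₀(ℕ+, ℝ) :=
  {f | ∃ (G : Finset ℕ+) (c : ℕ+ → ℤ), SchreierFamily L α G ∧
    ∀ i, f i = if i ∈ G then (c i : ℝ) else 0}

/-! ### Set-theoretic axioms -/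

/-- The Continuum Hypothesis. -/
def ContinuumHypothesis : Prop := (𝔠 : Cardinal.{0}) = ℵ₁

/-- Two conditions are compatible if they have a common lower bound. -/
def Compatible {P : Type*} [PartialOrder P] (p q : P) : Prop := ∃ r, r ≤ p ∧ r ≤ q

/-- The countable chain condition: every set of pairwise incompatible elements is countable. -/
def CountableChainCondition (P : Type*) [PartialOrder P] : Prop :=
  ∀ A : Set P, (A.Pairwise fun p q => ¬ Compatible p q) → A.Countable

/-- `D` is dense in the forcing sense. -/
def ForcingDense {P : Type*} [PartialOrder P] (D : Set P) : Prop := ∀ p, ∃ q ∈ D, q ≤ p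

/-- Martin's Axiom: for every nonempty ccc partial order and every family of fewer than `2^ℵ₀`
dense subsets there is a filter meeting all of them. -/
def MartinsAxiom : Prop :=
  ∀ (P : Type) [PartialOrder P] [Nonempty P], CountableChainCondition P →
    ∀ 𝒟 : Set (Set P), #𝒟 < 𝔠 → (∀ D ∈ 𝒟, ForcingDense D) →
      ∃ F : Order.PFilter P, ∀ D ∈ 𝒟, ∃ p ∈ F, p ∈ D

/-! Every separable metric space embeds coarsely into the finitely supported integer sequences with
the sup distance (`exists_scaleControlled_finsupp`), so it suffices to embed these into `M`, or
rather into the indices of a dense sequence of `M`.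

Each Schreier space embeds with some modulus `ℕ → ℕ`, and there are at most `ℵ₁ < 𝔠` of these
moduli. Martin's Axiom, applied to Hechler forcing, dominates all of them eventually, and a
pigeonhole over the finite errors gives one modulus `g` valid for cofinally many orders
(`MartinsAxiom.exists_cofinally_dominating`).

Enumerate the finitely supported sequences and consider the tree of finite lists of indices that
satisfy the constraints of a `g`-embedding on an initial segment of the enumeration. An infinite
branch is the required embedding. Without one, the tree is well-founded on a countable set and has
countable rank. But the Schreier family of order `α` contains a tree of rank at least `α`, which an
embedding of the Schreier space carries into this one (`LargeAt.le_rank_valuesAlong`); large `α`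
gives a contradiction. -/

/-! ### Hechler forcing and eventual domination -/

/-- Conditions of Hechler forcing: a finite initial segment of a function `ℕ → ℕ` together with a
finite set of functions which the remaining values have to dominate. -/
@[ext] structure HechlerCondition where
  stem : List ℕ
  side : Finset (ℕ → ℕ)

namespace HechlerCondition

instance : PartialOrder HechlerCondition where
  le p q := q.stem <+: p.stem ∧ q.side ⊆ p.side ∧
    ∀ f ∈ q.side, ∀ i (hi : i < p.stem.length), q.stem.length ≤ i → f i ≤ p.stem[i]
  le_refl p := ⟨List.prefix_refl _, Finset.Subset.refl _, fun _ _ i hi h => by omega⟩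
  le_trans p q r hpq hqr := by
    refine ⟨hqr.1.trans hpq.1, hqr.2.1.trans hpq.2.1, fun f hf i hi hri => ?_⟩
    rcases lt_or_ge i q.stem.length with h | h
    · rw [← hpq.1.getElem h]
      exact hqr.2.2 f hf i h hri
    · exact hpq.2.2 f (hqr.2.1 hf) i hi h
  le_antisymm p q hpq hqp := by
    ext1
    · exact hqp.1.eq_of_length (le_antisymm hqp.1.length_le hpq.1.length_le)
    · exact hqp.2.1.antisymm hpq.2.1

instance : Nonempty HechlerCondition := ⟨⟨[], ∅⟩⟩

theorem le_def {p q : HechlerCondition} : p ≤ q ↔ q.stem <+: p.stem ∧ q.side ⊆ p.side ∧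
    ∀ f ∈ q.side, ∀ i (hi : i < p.stem.length), q.stem.length ≤ i → f i ≤ p.stem[i] := Iff.rfl

theorem compatible_of_stem_eq {p q : HechlerCondition} (h : p.stem = q.stem) :
    Compatible p q := by
  classical
  refine ⟨⟨p.stem, p.side ∪ q.side⟩, le_def.2 ⟨List.prefix_refl _, Finset.subset_union_left, ?_⟩,
    le_def.2 ⟨by simp [h], Finset.subset_union_right, ?_⟩⟩
  · intro f _ i hi hi'
    exact absurd hi (not_lt.2 hi')
  · intro f _ i hi hi'
    exact absurd hi (not_lt.2 (h ▸ hi'))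

theorem countableChainCondition : CountableChainCondition HechlerCondition := by
  intro A hA
  refine Set.countable_of_injective_of_countable_image (f := stem) ?_ (Set.to_countable _)
  intro p hp q hq h
  by_contra hne
  exact hA hp hq hne (compatible_of_stem_eq h)

theorem forcingDense_side (f : ℕ → ℕ) : ForcingDense {p : HechlerCondition | f ∈ p.side} := by
  classical
  intro p
  refine ⟨⟨p.stem, insert f p.side⟩, Finset.mem_insert_self _ _,
    le_def.2 ⟨List.prefix_refl _, Finset.subset_insert _ _, ?_⟩⟩
  intro f _ i hi hi'
  exact absurd hi (not_lt.2 hi')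

theorem forcingDense_length (n : ℕ) :
    ForcingDense {p : HechlerCondition | n ≤ p.stem.length} := by
  induction n with
  | zero => exact fun p => ⟨p, Nat.zero_le _, le_rfl⟩
  | succ n ih =>
    intro p
    obtain ⟨q, hq, hqp⟩ := ih p
    -- The new entry is the maximum of the finitely many values it has to dominate.
    refine ⟨⟨q.stem ++ [q.side.sup fun f => f q.stem.length], q.side⟩, by simpa using hq,
      le_trans (le_def.2 ⟨List.prefix_append _ _, Finset.Subset.refl _, ?_⟩) hqp⟩
    intro f hf i hi hi'
    obtain rfl : i = q.stem.length := by
      simp only [List.length_append, List.length_singleton] at hi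
      omega
    simpa using Finset.le_sup (f := fun f : ℕ → ℕ => f q.stem.length) hf

end HechlerCondition

/-- Under Martin's Axiom every family of fewer than continuum many functions `ℕ → ℕ` is
eventually dominated by a single function. -/
theorem MartinsAxiom.exists_eventually_dominating (hMA : MartinsAxiom) (ℱ : Set (ℕ → ℕ))
    (hℱ : #ℱ < 𝔠) : ∃ g : ℕ → ℕ, ∀ f ∈ ℱ, ∃ N, ∀ n, N ≤ n → f n ≤ g n := by
  set side : (ℕ → ℕ) → Set HechlerCondition := fun f => {p | f ∈ p.side}
  set len : ℕ → Set HechlerCondition := fun n => {p | n ≤ p.stem.length}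
  obtain ⟨F, hF⟩ := hMA HechlerCondition HechlerCondition.countableChainCondition
    (side '' ℱ ∪ Set.range len)
    ((Cardinal.mk_union_le _ _).trans_lt (Cardinal.add_lt_of_lt Cardinal.aleph0_le_continuum
      (Cardinal.mk_image_le.trans_lt hℱ)
      ((Cardinal.mk_range_le.trans (Cardinal.mk_nat).le).trans_lt Cardinal.aleph0_lt_continuum)))
    (by
      rintro _ (⟨f, -, rfl⟩ | ⟨n, rfl⟩)
      · exact HechlerCondition.forcingDense_side f
      · exact HechlerCondition.forcingDense_length n)
  have hlen : ∀ n, ∃ p ∈ F, n < p.stem.length := fun n => hF (len (n + 1)) (.inr ⟨_, rfl⟩)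
  choose p hpF hp using hlen
  refine ⟨fun n => (p n).stem[n]'(hp n), fun f hf => ?_⟩
  obtain ⟨q, hqF, hq⟩ := hF (side f) (.inl ⟨f, hf, rfl⟩)
  refine ⟨q.stem.length, fun n hn => ?_⟩
  -- A common extension `r` keeps the entry chosen for `n`, and its entries past the stem of `q`
  -- dominate `f`.
  obtain ⟨r, -, hrp, hrq⟩ := F.directed _ (hpF n) _ hqF
  have hrp' := (HechlerCondition.le_def.1 hrp).1
  beta_reduce
  rw [hrp'.getElem (hp n)]
  exact (HechlerCondition.le_def.1 hrq).2.2 f hq n _ hn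

/-! ### Coarse embeddings between scaled sets -/

/-- The scale of a metric space, at integer radii. -/
def metricScale (X : Type*) [MetricSpace X] (n : ℕ) (x y : X) : Prop := dist x y ≤ n

/-- The scale of the supremum distance on integer valued functions. -/
def supScale {ι : Type*} (n : ℕ) (a b : ι → ℤ) : Prop := ∀ i, |a i - b i| ≤ n

/-- `f` is a coarse embedding with respect to two scales, with modulus `g` in both directions. -/
def ScaleControlled {X Y : Type*} (s : ℕ → X → X → Prop) (t : ℕ → Y → Y → Prop) (g : ℕ → ℕ)
    (f : X → Y) : Prop :=
  ∀ x y n, (s n x y → t (g n) (f x) (f y)) ∧ (t n (f x) (f y) → s (g n) x y)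

theorem metricScale_mono {X : Type*} [MetricSpace X] {m n : ℕ} (h : m ≤ n) {x y : X}
    (hxy : metricScale X m x y) : metricScale X n x y :=
  le_trans hxy (by exact_mod_cast h)

/-- Encodes both moduli in a single function `ℕ → ℕ`, the kind of object that eventual domination
handles. -/
theorem CoarselyEmbeds.exists_scaleControlled {X Y : Type*} [MetricSpace X] [MetricSpace Y]
    (h : CoarselyEmbeds X Y) :
    ∃ (f : X → Y) (g : ℕ → ℕ), ScaleControlled (metricScale X) (metricScale Y) g f := by
  obtain ⟨ρ, σ, hρ, hσ, hlim, f, hf⟩ := h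
  have hex : ∀ n : ℕ, ∃ m : ℕ, ∀ t : ℝ≥0, (m : ℝ≥0) ≤ t → (n : ℝ≥0) + 1 ≤ ρ t := by
    intro n
    obtain ⟨t₀, ht₀⟩ := Filter.eventually_atTop.1 (hlim.eventually_ge_atTop ((n : ℝ≥0) + 1))
    obtain ⟨m, hm⟩ := exists_nat_ge t₀
    exact ⟨m, fun t ht => ht₀ t (hm.trans ht)⟩
  choose m hm using hex
  refine ⟨f, fun n => max (m n) ⌈σ n⌉₊, fun x y n => ⟨fun h => ?_, fun h => ?_⟩⟩
  · have h' : nndist x y ≤ (n : ℝ≥0) := by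
      rw [← NNReal.coe_le_coe]; simpa [metricScale] using h
    have := ((hf x y).2.trans (hσ h')).trans (Nat.le_ceil _)
    refine metricScale_mono (le_max_right _ _) ?_
    rw [← NNReal.coe_le_coe] at this
    simpa [metricScale] using this
  · refine metricScale_mono (le_max_left _ _) ?_
    by_contra hlt
    have h1 : (m n : ℝ≥0) ≤ nndist x y := by
      rw [← NNReal.coe_le_coe]
      simpa using (not_le.1 hlt).le
    have h2 := (hm n _ h1).trans (hf x y).1
    rw [← NNReal.coe_le_coe] at h2
    simp only [metricScale] at h
    push_cast [coe_nndist] at h2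
    linarith

theorem ScaleControlled.coarselyEmbeds {X Y : Type*} [MetricSpace X] [MetricSpace Y] {f : X → Y}
    {g : ℕ → ℕ} (h : ScaleControlled (metricScale X) (metricScale Y) g f) :
    CoarselyEmbeds X Y := by
  set G : ℕ → ℕ := fun n => n + ∑ i ∈ Finset.range (n + 1), g i with hG
  have hGmono : Monotone G := fun a b hab => add_le_add hab
    (Finset.sum_le_sum_of_subset (Finset.range_mono (by omega)))
  have hgG : ∀ n, g n ≤ G n := fun n => le_trans
    (Finset.single_le_sum (f := g) (fun _ _ => Nat.zero_le _) (Finset.self_mem_range_succ n))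
    (Nat.le_add_left _ _)
  have hnG : ∀ n, n ≤ G n := fun n => Nat.le_add_right _ _
  classical
  -- The search bound `⌈t⌉₊` loses nothing, since `n ≤ G n < t`; if no `n` qualifies, the value is
  -- `0` and the lower bound is trivial.
  set r : ℝ≥0 → ℕ := fun t => Nat.findGreatest (fun n => (G n : ℝ≥0) < t) ⌈t⌉₊ with hr
  refine ⟨fun t => (r t : ℝ≥0), fun t => (G ⌈t⌉₊ : ℝ≥0), ?_, ?_, ?_, f, fun x y => ⟨?_, ?_⟩⟩
  · intro a b hab
    exact Nat.cast_le.2 (Nat.findGreatest_mono (fun n hn => lt_of_lt_of_le hn hab)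
      (Nat.ceil_mono hab))
  · intro a b hab
    exact Nat.cast_le.2 (hGmono (Nat.ceil_mono hab))
  · refine tendsto_natCast_atTop_atTop.comp (Filter.tendsto_atTop.2 fun n => ?_)
    filter_upwards [Filter.eventually_gt_atTop (G n : ℝ≥0)] with t ht
    refine Nat.le_findGreatest ?_ ht
    have : (n : ℝ≥0) ≤ ⌈t⌉₊ := (Nat.cast_le.2 (hnG n)).trans (ht.le.trans (Nat.le_ceil t))
    exact_mod_cast this
  · rcases Nat.eq_zero_or_pos (r (nndist x y)) with h0 | hpos
    · simp [h0]
    · have hspec : (G (r (nndist x y)) : ℝ≥0) < nndist x y :=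
        Nat.findGreatest_of_ne_zero (P := fun n => (G n : ℝ≥0) < nndist x y) rfl hpos.ne'
      by_contra hlt
      have h1 : metricScale Y (r (nndist x y)) (f x) (f y) := by
        have := (not_le.1 hlt).le
        rw [← NNReal.coe_le_coe] at this
        simpa [metricScale] using this
      have h2 := metricScale_mono (hgG _) ((h x y _).2 h1)
      rw [← NNReal.coe_lt_coe] at hspec
      simp only [metricScale] at h2
      push_cast [coe_nndist] at hspec
      linarith
  · have h1 : metricScale X ⌈nndist x y⌉₊ x y := by
      have := Nat.le_ceil (nndist x y)
      rw [← NNReal.coe_le_coe] at this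
      simpa [metricScale] using this
    have h2 := metricScale_mono (hgG _) ((h x y _).1 h1)
    rw [← NNReal.coe_le_coe]
    simpa [metricScale] using h2

theorem ScaleControlled.mono_modulus {X Y : Type*} [MetricSpace X] [MetricSpace Y] {ι : Type*}
    {p : ι → Y} {f : X → ι} {g g' : ℕ → ℕ} (hg : ∀ n, g n ≤ g' n)
    (h : ScaleControlled (metricScale X) (fun n i j => metricScale Y n (p i) (p j)) g f) :
    ScaleControlled (metricScale X) (fun n i j => metricScale Y n (p i) (p j)) g' f :=
  fun x y n => ⟨fun hs => metricScale_mono (hg n) ((h x y n).1 hs),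
    fun ht => metricScale_mono (hg n) ((h x y n).2 ht)⟩

/-- A coarse embedding can be perturbed so as to take its values in a dense sequence. -/
theorem ScaleControlled.exists_denseRange {X Y : Type*} [MetricSpace X] [MetricSpace Y]
    {ι : Type*} {p : ι → Y} (hp : DenseRange p) {f : X → Y} {g : ℕ → ℕ}
    (h : ScaleControlled (metricScale X) (metricScale Y) g f) :
    ∃ (f' : X → ι) (g' : ℕ → ℕ),
      ScaleControlled (metricScale X) (fun n i j => metricScale Y n (p i) (p j)) g' f' := by
  choose f' hf' using fun x => hp.exists_dist_lt (f x) one_pos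
  refine ⟨f', fun n => max (g n + 2) (g (n + 2)), fun x y n => ⟨fun hs => ?_, fun ht => ?_⟩⟩
  · refine metricScale_mono (le_max_left _ _) ?_
    have h1 : dist (f x) (f y) ≤ g n := (h x y n).1 hs
    have h2 := dist_triangle4 (p (f' x)) (f x) (f y) (p (f' y))
    have h3 := hf' x
    have h4 := hf' y
    rw [dist_comm] at h3
    simp only [metricScale]
    push_cast
    linarith
  · refine metricScale_mono (le_max_right _ _) ((h x y (n + 2)).2 ?_)
    have h2 := dist_triangle4 (f x) (p (f' x)) (p (f' y)) (f y)
    have h3 := hf' x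
    have h4 := hf' y
    rw [dist_comm] at h4
    simp only [metricScale] at ht ⊢
    push_cast
    linarith

/-! ### Uniform moduli along the countable ordinals -/

/-- Each `h α` lies below `max g K` for some natural number `K`. If every `K` worked only for `α`
below some `b K < ω₁`, then no `K` would work at the countable ordinal `⨆ K, b K`. -/
theorem MartinsAxiom.exists_cofinally_dominating (hMA : MartinsAxiom)
    (hCH : ¬ ContinuumHypothesis) (h : Ordinal.{0} → ℕ → ℕ) :
    ∃ g : ℕ → ℕ, ∀ γ < ω₁, ∃ α, γ ≤ α ∧ α < ω₁ ∧ ∀ n, h α n ≤ g n := by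
  have hcard : #(h '' Set.Iio ω₁) < 𝔠 := by
    have h1 : ℵ₁ < 𝔠 := lt_of_le_of_ne Cardinal.aleph_one_le_continuum fun e => hCH e.symm
    refine lt_of_le_of_lt ?_ h1
    have h2 := Cardinal.mk_image_le_lift (f := h) (s := Set.Iio ω₁)
    rw [Cardinal.mk_Iio_ordinal] at h2
    simpa using h2
  obtain ⟨g, hg⟩ := hMA.exists_eventually_dominating _ hcard
  have hK : ∀ α, α < ω₁ → ∃ K, ∀ n, h α n ≤ max (g n) K := by
    intro α hα
    obtain ⟨N, hN⟩ := hg _ ⟨α, hα, rfl⟩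
    refine ⟨(Finset.range N).sup (h α), fun n => ?_⟩
    rcases lt_or_ge n N with hn | hn
    · exact le_max_of_le_right (Finset.le_sup (Finset.mem_range.2 hn))
    · exact le_max_of_le_left (hN n hn)
  by_contra hcon
  push Not at hcon
  choose b hb hbound using fun K : ℕ => hcon fun n => max (g n) K
  obtain ⟨K, hK⟩ := hK (⨆ K, b K) (Ordinal.iSup_lt_omega_one hb)
  obtain ⟨n, hn⟩ := hbound K _ (Ordinal.le_iSup b K) (Ordinal.iSup_lt_omega_one hb)
  exact absurd (hK n) (not_le.2 hn)

/-! ### Ranks of trees of finite sequences -/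

/-- `l'` extends `l` by one entry, and all pairs of entries of `l'` satisfy `Q`. -/
def ExtendsGood {β : Type*} (Q : ℕ → ℕ → β → β → Prop) (l' l : List β) : Prop :=
  (∀ i j (hi : i < l'.length) (hj : j < l'.length), Q i j l'[i] l'[j]) ∧ ∃ b, l' = l ++ [b]

/-- The lists of a descending chain extend one another, so they have a limit; any two of its entries
lie in a common good list. -/
theorem exists_branch_of_not_wellFounded {β : Type*} {Q : ℕ → ℕ → β → β → Prop}
    (h : ¬ WellFounded (ExtendsGood Q)) : ∃ u : ℕ → β, ∀ i j, Q i j (u i) (u j) := by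
  rw [wellFounded_iff_isEmpty_descending_chain, not_isEmpty_iff] at h
  obtain ⟨f, hf⟩ := h
  have hpre : ∀ m n, m ≤ n → f m <+: f n := by
    intro m n hmn
    induction n, hmn using Nat.le_induction with
    | base => exact List.prefix_refl _
    | succ n _ ih =>
      obtain ⟨b, hb⟩ := (hf n).2
      exact ih.trans (hb ▸ List.prefix_append _ _)
  have hlen : ∀ n, n ≤ (f n).length := by
    intro n
    induction n with
    | zero => exact Nat.zero_le _
    | succ n ih =>
      obtain ⟨b, hb⟩ := (hf n).2
      rw [hb]
      simpa using ih
  refine ⟨fun i => (f (i + 1))[i]'(hlen (i + 1)), fun i j => ?_⟩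
  have hi : i + 1 ≤ max i j + 1 := by omega
  have hj : j + 1 ≤ max i j + 1 := by omega
  beta_reduce
  rw [(hpre _ _ hi).getElem (hlen (i + 1)), (hpre _ _ hj).getElem (hlen (j + 1))]
  exact (hf (max i j)).1 i j _ _

/-- A rank is a supremum of successors of smaller ranks, here over a countable index set. -/
theorem IsWellFounded.rank_lt_omega_one {β : Type} [Countable β] (r : β → β → Prop)
    [IsWellFounded β r] (a : β) : IsWellFounded.rank r a < ω₁ := by
  induction a using IsWellFounded.induction r with
  | _ a ih =>
    rw [IsWellFounded.rank_eq]
    exact Ordinal.iSup_lt_omega_one fun b => (Cardinal.isSuccLimit_omega 1).succ_lt (ih b b.2)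

/-- `LargeAt F γ l` says that, in the tree of all increasing sequences whose sets of entries belong
to `F`, the node `l` has rank at least `γ`. -/
inductive LargeAt (F : Finset ℕ+ → Prop) : Ordinal.{0} → List ℕ+ → Prop
  | intro (γ : Ordinal.{0}) (l : List ℕ+) (mem : F l.toFinset) (n : Ordinal.{0} → ℕ+)
      (lt : ∀ δ < γ, ∀ m ∈ l, m < n δ) (ext : ∀ δ < γ, LargeAt F δ (l ++ [n δ])) :
      LargeAt F γ l

namespace LargeAt

variable {F F' : Finset ℕ+ → Prop} {γ δ : Ordinal.{0}} {l : List ℕ+}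

theorem mem (h : LargeAt F γ l) : F l.toFinset := by
  cases h; assumption

theorem exists_extension (h : LargeAt F γ l) (hδ : δ < γ) :
    ∃ n, (∀ m ∈ l, m < n) ∧ LargeAt F δ (l ++ [n]) := by
  cases h with
  | intro _ _ _ n lt ext => exact ⟨n δ, lt δ hδ, ext δ hδ⟩

theorem of_exists (mem : F l.toFinset)
    (h : ∀ δ < γ, ∃ n, (∀ m ∈ l, m < n) ∧ LargeAt F δ (l ++ [n])) : LargeAt F γ l := by
  choose! n lt ext using h
  exact .intro γ l mem n lt ext

theorem anti (h : LargeAt F γ l) (hδ : δ ≤ γ) : LargeAt F δ l :=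
  of_exists h.mem fun _ hε => h.exists_extension (hε.trans_le hδ)

theorem mono (hF : ∀ A, F A → F' A) (h : LargeAt F γ l) : LargeAt F' γ l := by
  induction h with
  | intro γ l mem n lt _ ih => exact .intro γ l (hF _ mem) n lt ih

/-- Putting `k` in front of every sequence of a tree does not change the ranks. -/
theorem cons {k : ℕ+} (hF : ∀ A, F A → F' (insert k A) ∧ ∀ m ∈ A, k < m) (h : LargeAt F γ l) :
    LargeAt F' γ (k :: l) := by
  induction h with
  | intro γ l mem n lt ext ih =>
    refine .intro γ _ (by simpa using (hF _ mem).1) n (fun δ hδ m hm => ?_) ih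
    rcases List.mem_cons.1 hm with rfl | hm
    · exact (hF _ (ext δ hδ).mem).2 _ (by simp)
    · exact lt δ hδ m hm

end LargeAt

/-! ### Schreier families are large -/

/-- `A` is contained in a member of the Schreier family of order `α` whose elements are `≥ N`. -/
def SchreierSubset (L : LadderSystem) (α : Ordinal.{0}) (N : ℕ+) (A : Finset ℕ+) : Prop :=
  ∃ G, SchreierFamily L α G ∧ A ⊆ G ∧ ∀ m ∈ G, N ≤ m

theorem SchreierFamily.singleton (L : LadderSystem) (n : ℕ+) {α : Ordinal.{0}} (hα : α < ω₁) :
    SchreierFamily L α {n} := by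
  induction α using Ordinal.limitRecOn with
  | zero => exact .zero n
  | add_one α ih =>
    have h := SchreierFamily.succ (L := L) α 1 (fun _ => {n})
      (fun _ => ih ((lt_add_one α).trans hα)) (fun _ _ _ => one_le)
      (fun i j hij => by
        have hi : (i : ℕ) < 1 := i.2
        have hj : (j : ℕ) < 1 := j.2
        have : (i : ℕ) < j := hij
        omega)
    have e : (Finset.univ : Finset (Fin ((1 : ℕ+) : ℕ))).biUnion (fun _ => ({n} : Finset ℕ+))
        = {n} := by
      ext m
      exact Finset.mem_biUnion.trans ⟨fun ⟨_, _, hm⟩ => hm,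
        fun hm => ⟨(0 : Fin 1), Finset.mem_univ _, hm⟩⟩
    rwa [e] at h
  | limit β hβ ih =>
    exact .limit β hβ 1 _ (fun _ _ => one_le)
      (ih _ (L.seq_lt β hα hβ 1) ((L.seq_lt β hα hβ 1).trans hα))

theorem SchreierFamily.insert {L : LadderSystem} {α : Ordinal.{0}} (hα : α < ω₁) {n : ℕ+}
    (hn : 2 ≤ n) {G : Finset ℕ+} (hG : SchreierFamily L α G) (hlt : ∀ m ∈ G, n < m) :
    SchreierFamily L (α + 1) (insert n G) := by
  -- Two blocks, `{n}` and `G`, are admissible because `2 ≤ n`.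
  have h := SchreierFamily.succ (L := L) α 2 (![{n}, G] : Fin 2 → Finset ℕ+)
    (Fin.forall_fin_two.2 ⟨SchreierFamily.singleton L n hα, hG⟩)
    (Fin.forall_fin_two.2 ⟨by simpa using hn, fun m hm => hn.trans (hlt m hm).le⟩)
    (by
      refine Fin.forall_fin_two.2 ⟨Fin.forall_fin_two.2 ⟨fun h => absurd h (lt_irrefl _), ?_⟩,
        Fin.forall_fin_two.2 ⟨fun h => absurd h (by decide), fun h => absurd h (lt_irrefl _)⟩⟩
      intro _ k hk m hm
      obtain rfl : k = n := by simpa using hk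
      exact hlt m hm)
  convert h using 1
  ext m
  refine Finset.mem_insert.trans (Iff.trans ?_ Finset.mem_biUnion.symm)
  constructor
  · rintro (rfl | hm)
    · exact ⟨(0 : Fin 2), Finset.mem_univ _, by simp⟩
    · exact ⟨(1 : Fin 2), Finset.mem_univ _, hm⟩
  · rintro ⟨i, -, hi⟩
    revert hi
    exact (Fin.forall_fin_two (p := fun i => m ∈ (![{n}, G] : Fin 2 → Finset ℕ+) i →
      m = n ∨ m ∈ G)).2 ⟨fun h => .inl (by simpa using h), fun h => .inr h⟩ i

/-- At a successor, one entry is placed in front of a tree of order `α` that lives beyond it. At a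
limit, a tree of order `L.seq β k > δ` is used beyond `k`; this is why `N` varies in the induction.
Subsets of members are needed because nodes are initial segments and the families need not be
hereditary: order `0` lacks the empty set. -/
theorem largeAt_schreierSubset (L : LadderSystem) {α : Ordinal.{0}} (hα : α < ω₁) (N : ℕ+) :
    LargeAt (SchreierSubset L α N) α [] := by
  have hempty : ∀ {α}, α < ω₁ → ∀ N, SchreierSubset L α N (List.toFinset []) :=
    fun hα N => ⟨{N}, SchreierFamily.singleton L N hα, by simp, by simp⟩
  induction α using Ordinal.limitRecOn generalizing N with
  | zero => exact .of_exists (hempty hα N) fun δ hδ => absurd hδ (not_lt.2 zero_le)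
  | add_one α ih =>
    have hα' := (lt_add_one α).trans hα
    refine .of_exists (hempty hα N) fun δ hδ => ⟨max N 2, by simp, ?_⟩
    refine ((ih hα' (max N 2 + 1)).cons fun A hA => ?_).anti (Order.lt_add_one_iff.1 hδ)
    obtain ⟨G, hG, hAG, hN⟩ := hA
    have hlt : ∀ m ∈ G, max N 2 < m := fun m hm => PNat.add_one_le_iff.1 (hN m hm)
    refine ⟨⟨insert (max N 2) G, hG.insert hα' (le_max_right _ _) hlt,
      Finset.insert_subset_insert _ hAG, fun m hm => ?_⟩, fun m hm => hlt m (hAG hm)⟩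
    rcases Finset.mem_insert.1 hm with rfl | hm
    · exact le_max_left _ _
    · exact (le_max_left _ _).trans (hlt m hm).le
  | limit β hβ ih =>
    refine .of_exists (hempty hα N) fun δ hδ => ?_
    obtain ⟨k, hk⟩ := L.exists_lt_seq β hα hβ δ hδ
    have hlt := L.seq_lt β hα hβ k
    obtain ⟨n, hn, hlarge⟩ := (ih _ hlt (hlt.trans hα) (max N k)).exists_extension hk
    refine ⟨n, hn, hlarge.mono ?_⟩
    rintro A ⟨G, hG, hAG, hN⟩
    exact ⟨G, .limit β hβ k G (fun m hm => (le_max_right _ _).trans (hN m hm)) hG, hAG,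
      fun m hm => (le_max_left _ _).trans (hN m hm)⟩

/-! ### Embedding separable metric spaces into finitely supported integer sequences -/

section SeparableEmbedding

variable {X : Type*} [MetricSpace X] (x : ℕ → X)

/-- The minimum of `r` and of the numbers `dist z (x i) - r` for `i < j`. -/
noncomputable def distToEarlier (r : ℝ) (z : X) : ℕ → ℝ
  | 0 => r
  | j + 1 => min (distToEarlier r z j) (dist z (x j) - r)

/-- A bump function of height at most `r`, supported in the ball of radius `3r` around `x j` and
vanishing on the balls of radius `r` around the points `x i`, `i < j`. -/
noncomputable def bump (r : ℝ) (j : ℕ) (z : X) : ℝ :=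
  max 0 (min (distToEarlier x r z j) (3 * r - dist z (x j)))

variable {x} {r : ℝ} {y z : X} {i j : ℕ}

theorem abs_distToEarlier_sub_le (r : ℝ) (y z : X) (j : ℕ) :
    |distToEarlier x r y j - distToEarlier x r z j| ≤ dist y z := by
  induction j with
  | zero => simp [distToEarlier]
  | succ j ih =>
    refine (abs_min_sub_min_le_max _ _ _ _).trans (max_le ih ?_)
    rw [sub_sub_sub_cancel_right]
    exact abs_dist_sub_le _ _ _

theorem abs_bump_sub_le (r : ℝ) (j : ℕ) (y z : X) :
    |bump x r j y - bump x r j z| ≤ dist y z := by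
  refine (abs_max_sub_max_le_max _ _ _ _).trans (max_le (by simp) ?_)
  refine (abs_min_sub_min_le_max _ _ _ _).trans (max_le (abs_distToEarlier_sub_le _ _ _ _) ?_)
  rw [sub_sub_sub_cancel_left, abs_sub_comm]
  exact abs_dist_sub_le _ _ _

theorem distToEarlier_le (hij : i < j) : distToEarlier x r z j ≤ dist z (x i) - r := by
  induction j, hij using Nat.le_induction with
  | base => exact min_le_right _ _
  | succ j _ ih => exact (min_le_left _ _).trans ih

theorem distToEarlier_le_radius (j : ℕ) : distToEarlier x r z j ≤ r := by
  induction j with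
  | zero => exact le_rfl
  | succ j ih => exact (min_le_left _ _).trans ih

theorem distToEarlier_eq_radius (h : ∀ i < j, 2 * r ≤ dist z (x i)) :
    distToEarlier x r z j = r := by
  induction j with
  | zero => rfl
  | succ j ih =>
    rw [distToEarlier, ih fun i hi => h i (hi.trans j.lt_succ_self)]
    exact min_eq_left (by linarith [h j j.lt_succ_self])

theorem bump_eq_zero_of_dist_le (hij : i < j) (h : dist z (x i) ≤ r) : bump x r j z = 0 :=
  max_eq_left ((min_le_left _ _).trans ((distToEarlier_le hij).trans (by linarith)))

theorem bump_eq_zero_of_le_dist (h : 3 * r ≤ dist z (x j)) : bump x r j z = 0 :=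
  max_eq_left ((min_le_right _ _).trans (by linarith))

theorem bump_eq_radius (hr : 0 ≤ r) (h : ∀ i < j, 2 * r ≤ dist z (x i))
    (hj : dist z (x j) ≤ 2 * r) : bump x r j z = r := by
  rw [bump, distToEarlier_eq_radius h, min_eq_left (by linarith), max_eq_right hr]

theorem bump_radius_zero (j : ℕ) (z : X) : bump x 0 j z = 0 :=
  max_eq_left ((min_le_left _ _).trans (distToEarlier_le_radius j))

/-- Near `x 0` the bump of index `0` is constantly `r` and all others vanish. -/
theorem bump_eq_bump_base (h : dist z (x 0) ≤ r) (j : ℕ) : bump x r j z = bump x r j (x 0) := by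
  have hr : 0 ≤ r := dist_nonneg.trans h
  rcases Nat.eq_zero_or_pos j with rfl | hj
  · rw [bump_eq_radius hr (by simp) (by linarith), bump_eq_radius hr (by simp) (by simpa using hr)]
  · rw [bump_eq_zero_of_dist_le hj h, bump_eq_zero_of_dist_le hj (by simpa using hr)]

/-- Some bump function of radius `r` separates points at distance at least `5r`. -/
theorem exists_bump_separating (hx : DenseRange x) (hr : 0 < r) (h : 5 * r ≤ dist y z) :
    ∃ j, bump x r j y = r ∧ bump x r j z = 0 := by
  classical
  have hex : ∃ j, dist y (x j) < 2 * r := hx.exists_dist_lt y (by linarith)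
  have hj := Nat.find_spec hex
  -- For the first `x j` within `2r` of `y`, minimality gives the value `r` at `y`, while `z` is at
  -- distance at least `5r - 2r` from `x j`.
  refine ⟨Nat.find hex, bump_eq_radius hr.le (fun i hi => not_lt.1 (Nat.find_min hex hi)) hj.le,
    bump_eq_zero_of_le_dist ?_⟩
  have := dist_triangle_right y z (x (Nat.find hex))
  linarith

/-- The integer parts of the bump functions of integer radii, normalized to vanish at `x 0`. -/
noncomputable def bumpCoordinate (x : ℕ → X) (z : X) (p : ℕ × ℕ) : ℤ :=
  ⌊bump x p.1 p.2 z⌋ - ⌊bump x p.1 p.2 (x 0)⌋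

/-- Radii `r ≥ dist z (x 0)` contribute nothing after normalization. For each smaller positive `r`,
a point `x i` within `r` of `z` kills all indices `j > i`. -/
theorem finite_support_bumpCoordinate (hx : DenseRange x) (z : X) :
    (Function.support (bumpCoordinate x z)).Finite := by
  have hex : ∀ r : ℕ, ∃ i, r ≠ 0 → dist z (x i) ≤ r := by
    intro r
    rcases Nat.eq_zero_or_pos r with rfl | hr
    · exact ⟨0, by simp⟩
    · obtain ⟨i, hi⟩ := hx.exists_dist_lt z (Nat.cast_pos.2 hr : (0 : ℝ) < r)
      exact ⟨i, fun _ => hi.le⟩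
  choose i hi using hex
  refine Set.Finite.subset ((Finset.range ⌈dist z (x 0)⌉₊).sigma
    (fun r => Finset.range (i r + 1)) |>.finite_toSet.image fun p => (p.1, p.2)) ?_
  rintro ⟨r, j⟩ hp
  refine ⟨⟨r, j⟩, ?_, rfl⟩
  simp only [Finset.coe_sigma, Set.mem_sigma_iff, Finset.coe_range, Set.mem_Iio]
  constructor
  · by_contra hcon
    refine hp ?_
    have : dist z (x 0) ≤ r := (Nat.le_ceil _).trans (by exact_mod_cast not_lt.1 hcon)
    simp [bumpCoordinate, bump_eq_bump_base this]
  · by_contra hcon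
    refine hp ?_
    rcases eq_or_ne r 0 with rfl | hr
    · simp [bumpCoordinate, bump_radius_zero]
    · have hj : i r < j := by omega
      have h0 : bump x r j (x 0) = 0 :=
        bump_eq_zero_of_dist_le (lt_of_le_of_lt (Nat.zero_le _) hj) (by simp)
      simp [bumpCoordinate, bump_eq_zero_of_dist_le hj (hi r hr), h0]

theorem abs_bumpCoordinate_sub_le {n : ℕ} (h : dist y z ≤ n) (p : ℕ × ℕ) :
    |bumpCoordinate x y p - bumpCoordinate x z p| ≤ n + 1 := by
  have h1 := abs_le.1 ((abs_bump_sub_le (x := x) p.1 p.2 y z).trans h)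
  have hy := Int.floor_le (bump x p.1 p.2 y)
  have hy' := Int.lt_floor_add_one (bump x p.1 p.2 y)
  have hz := Int.floor_le (bump x p.1 p.2 z)
  have hz' := Int.lt_floor_add_one (bump x p.1 p.2 z)
  rw [bumpCoordinate, bumpCoordinate, sub_sub_sub_cancel_right, abs_le]
  constructor
  · have : (-((n : ℤ) + 1) : ℝ) ≤ (⌊bump x p.1 p.2 y⌋ - ⌊bump x p.1 p.2 z⌋ : ℝ) := by
      push_cast
      linarith [h1.1]
    exact_mod_cast this
  · have : (⌊bump x p.1 p.2 y⌋ - ⌊bump x p.1 p.2 z⌋ : ℝ) ≤ ((n : ℤ) + 1 : ℝ) := by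
      push_cast
      linarith [h1.2]
    exact_mod_cast this

theorem dist_le_of_abs_bumpCoordinate_sub_le (hx : DenseRange x) {n : ℕ}
    (h : ∀ p, |bumpCoordinate x y p - bumpCoordinate x z p| ≤ n) :
    dist y z ≤ 5 * (n + 1 : ℕ) := by
  by_contra hcon
  -- A bump of radius `n + 1` yields a coordinate difference of exactly `n + 1`, exceeding `n`.
  obtain ⟨j, hy, hz⟩ := exists_bump_separating (r := ((n + 1 : ℕ) : ℝ)) hx
    (by positivity) (not_le.1 hcon).le
  have := h (n + 1, j)
  simp only [bumpCoordinate, sub_sub_sub_cancel_right, hy, hz, Int.floor_natCast,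
    Int.floor_zero, sub_zero] at this
  rw [abs_of_nonneg (by positivity)] at this
  push_cast at this
  omega

end SeparableEmbedding

theorem exists_scaleControlled_finsupp (X : Type*) [MetricSpace X]
    [TopologicalSpace.SeparableSpace X] [Nonempty X] :
    ∃ (f : X → ℕ →₀ ℤ) (g : ℕ → ℕ),
      ScaleControlled (metricScale X) (fun n (a b : ℕ →₀ ℤ) => supScale n a b) g f := by
  set x := TopologicalSpace.denseSeq X
  have hx : DenseRange x := TopologicalSpace.denseRange_denseSeq X
  refine ⟨fun z => (Finsupp.ofSupportFinite _
    (finite_support_bumpCoordinate hx z)).equivMapDomain Nat.pairEquiv,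
    fun n => 5 * (n + 1), fun y z n => ⟨fun h i => ?_, fun h => ?_⟩⟩
  · refine (abs_bumpCoordinate_sub_le h (Nat.pairEquiv.symm i)).trans ?_
    push_cast
    omega
  · have := dist_le_of_abs_bumpCoordinate_sub_le (y := y) (z := z) hx (n := n) fun p => by
      have hp := h (Nat.pairEquiv p)
      simp only [Finsupp.equivMapDomain_apply, Equiv.symm_apply_apply] at hp
      exact hp
    simp only [metricScale]
    exact_mod_cast this

/-! ### From Schreier spaces to finitely supported integer sequences -/

/-- `v` vanishes outside of some member of the Schreier family of order `α`. -/
def SchreierSupported (L : LadderSystem) (α : Ordinal.{0}) (v : ℕ+ → ℤ) : Prop :=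
  ∃ G, SchreierFamily L α G ∧ ∀ i ∉ G, v i = 0

/-- An integer valued function with support in a Schreier set, as an element of `c₀`. -/
noncomputable def SchreierSupported.toSpace {L : LadderSystem} {α : Ordinal.{0}} {v : ℕ+ → ℤ}
    (h : SchreierSupported L α v) : SchreierSpace L α :=
  ⟨{ toFun := fun i => (v i : ℝ)
     continuous_toFun := continuous_of_discreteTopology
     zero_at_infty' := by
      obtain ⟨G, -, hG⟩ := h
      refine tendsto_const_nhds.congr' ?_
      rw [Filter.cocompact_eq_cofinite]
      filter_upwards [G.finite_toSet.compl_mem_cofinite] with i hi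
      simp [hG i hi] },
    h.choose, v, h.choose_spec.1, fun i => by
      split_ifs with hi
      · rfl
      · exact Int.cast_eq_zero.2 (h.choose_spec.2 i hi)⟩

theorem SchreierSupported.metricScale_toSpace_iff {L : LadderSystem} {α : Ordinal.{0}}
    {v w : ℕ+ → ℤ} (hv : SchreierSupported L α v) (hw : SchreierSupported L α w) (n : ℕ) :
    metricScale (SchreierSpace L α) n hv.toSpace hw.toSpace ↔ supScale n v w := by
  rw [metricScale, Subtype.dist_eq, ← ZeroAtInftyContinuousMap.dist_toBCF_eq_dist,
    BoundedContinuousFunction.dist_le n.cast_nonneg]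
  refine forall_congr' fun i => ?_
  change |((v i : ℝ) - (w i : ℝ))| ≤ n ↔ _
  exact_mod_cast Iff.rfl

/-- Every finitely supported integer sequence is enumerated by a sequence whose `j`-th term is
supported in the first `j` coordinates. -/
theorem exists_enumeration_finsupp :
    ∃ x : ℕ → ℕ →₀ ℤ, Function.Surjective x ∧ ∀ j i, j ≤ i → x j i = 0 := by
  classical
  obtain ⟨e, he⟩ := exists_surjective_nat (ℕ →₀ ℤ)
  -- Unpairing lists every sequence infinitely often, hence also at an index beyond its support;
  -- elsewhere `0` is a harmless filler.
  refine ⟨fun j => if ∀ i, j ≤ i → e j.unpair.1 i = 0 then e j.unpair.1 else 0, fun a => ?_,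
    fun j i hji => ?_⟩
  · obtain ⟨k, rfl⟩ := he a
    have hN : ∀ i, (e k).support.sup id + 1 ≤ i → e k i = 0 := by
      intro i hi
      by_contra hne
      have := Finset.le_sup (f := id) (Finsupp.mem_support_iff.2 hne)
      simp only [id] at this
      omega
    refine ⟨Nat.pair k ((e k).support.sup id + 1), ?_⟩
    simp only [Nat.unpair_pair]
    exact if_pos fun i hi => hN i ((Nat.right_le_pair _ _).trans hi)
  · beta_reduce
    split_ifs with h
    · exact h i hji
    · rfl

/-- The sequence `a`, placed along the entries of `l`. -/
def placeAlong (l : List ℕ+) (a : ℕ → ℤ) (i : ℕ+) : ℤ := if i ∈ l then a (l.idxOf i) else 0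

/-- Makes the values of `Φ` at earlier terms of the enumeration stable when `l` is extended. -/
theorem placeAlong_append_singleton {l : List ℕ+} {n : ℕ+} (hn : n ∉ l) {a : ℕ → ℤ}
    (ha : a l.length = 0) : placeAlong (l ++ [n]) a = placeAlong l a := by
  ext i
  by_cases hi : i ∈ l
  · simp [placeAlong, hi, List.idxOf_append_of_mem hi]
  · by_cases hin : i = n
    · subst hin
      simp [placeAlong, hi, List.idxOf_append_of_notMem hi, ha]
    · simp [placeAlong, hi, hin]

theorem supScale_placeAlong_iff {l : List ℕ+} (hl : l.Nodup) {a b : ℕ → ℤ}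
    (ha : ∀ i, l.length ≤ i → a i = 0) (hb : ∀ i, l.length ≤ i → b i = 0) (n : ℕ) :
    supScale n (placeAlong l a) (placeAlong l b) ↔ supScale n a b := by
  constructor
  · intro h i
    rcases lt_or_ge i l.length with hi | hi
    · have hil := h l[i]
      rwa [placeAlong, placeAlong, if_pos (List.getElem_mem hi), if_pos (List.getElem_mem hi),
        hl.idxOf_getElem i hi] at hil
    · simp [ha i hi, hb i hi]
  · intro h i
    by_cases hi : i ∈ l
    · simpa [placeAlong, hi] using h (l.idxOf i)
    · simp [placeAlong, hi]

section Tree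

variable {L : LadderSystem} {α γ : Ordinal.{0}} {t : ℕ → ℕ → ℕ → Prop} {g : ℕ → ℕ}
  {x : ℕ → ℕ →₀ ℤ} {Φ : (ℕ+ → ℤ) → ℕ}

/-- The sequence of values taken by `Φ` at the first `l.length` terms of `x`, placed along `l`. -/
def valuesAlong (x : ℕ → ℕ →₀ ℤ) (Φ : (ℕ+ → ℤ) → ℕ) (l : List ℕ+) : List ℕ :=
  (List.range l.length).map fun i => Φ (placeAlong l (x i))

theorem valuesAlong_append_singleton (hx : ∀ j i, j ≤ i → x j i = 0) {l : List ℕ+} {n : ℕ+}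
    (hn : n ∉ l) : valuesAlong x Φ (l ++ [n]) =
      valuesAlong x Φ l ++ [Φ (placeAlong (l ++ [n]) (x l.length))] := by
  rw [valuesAlong, List.length_append, List.length_singleton, List.range_succ, List.map_append]
  congr 1
  refine List.map_congr_left fun i hi => ?_
  rw [placeAlong_append_singleton hn (hx i _ (List.mem_range.1 hi).le)]

/-- The constraints on the values at the `i`-th and the `j`-th term of `x` of a coarse embedding
with modulus `g`. -/
def PairConstraint (t : ℕ → ℕ → ℕ → Prop) (g : ℕ → ℕ) (x : ℕ → ℕ →₀ ℤ) (i j a b : ℕ) : Prop :=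
  ∀ n, (supScale n (x i) (x j) → t (g n) a b) ∧ (t n a b → supScale (g n) (x i) (x j))

/-- Extending `l` by one entry appends one value to `valuesAlong x Φ l`, and the new list satisfies
the constraints because all placed terms are supported in one Schreier set. Descending in the
Schreier tree thus descends in the tree of partial embeddings, so ranks compare. -/
theorem LargeAt.le_rank_valuesAlong (hx : ∀ j i, j ≤ i → x j i = 0)
    [IsWellFounded (List ℕ) (ExtendsGood (PairConstraint t g x))]
    (hΦ : ∀ v w, SchreierSupported L α v → SchreierSupported L α w → ∀ n,
      (supScale n v w → t (g n) (Φ v) (Φ w)) ∧ (t n (Φ v) (Φ w) → supScale (g n) v w))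
    {l : List ℕ+} (hl : l.Nodup) (h : LargeAt (SchreierSubset L α 1) γ l) :
    γ ≤ IsWellFounded.rank (ExtendsGood (PairConstraint t g x)) (valuesAlong x Φ l) := by
  induction h with
  | intro γ l mem n lt ext ih =>
    refine le_of_forall_lt fun δ hδ => ?_
    have hn : n δ ∉ l := fun hmem => lt_irrefl _ (lt δ hδ _ hmem)
    have hnodup : (l ++ [n δ]).Nodup := hl.append (List.nodup_singleton _) (by simpa using hn)
    refine (ih δ hδ hnodup).trans_lt (IsWellFounded.rank_lt_of_rel
      ⟨?_, _, valuesAlong_append_singleton hx hn⟩)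
    obtain ⟨G, hG, hsub, -⟩ := (ext δ hδ).mem
    have hsupp : ∀ a, SchreierSupported L α (placeAlong (l ++ [n δ]) a) := fun a =>
      ⟨G, hG, fun i hi => if_neg fun hmem => hi (hsub (List.mem_toFinset.2 hmem))⟩
    intro i j hi hj m
    have hi' : i < (l ++ [n δ]).length := by simpa [valuesAlong] using hi
    have hj' : j < (l ++ [n δ]).length := by simpa [valuesAlong] using hj
    have key := fun m => supScale_placeAlong_iff hnodup (n := m)
      (fun k hk => hx i k (hi'.le.trans hk)) (fun k hk => hx j k (hj'.le.trans hk))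
    have := hΦ _ _ (hsupp (x i)) (hsupp (x j)) m
    rw [key, key] at this
    simpa [valuesAlong] using this

/-- If the spaces of Schreier supported functions embed with a common modulus for cofinally many
countable orders, then so does the space of all finitely supported integer sequences. -/
theorem exists_scaleControlled_of_cofinally
    (h : ∀ γ < ω₁, ∃ α, γ ≤ α ∧ α < ω₁ ∧ ∃ Φ : (ℕ+ → ℤ) → ℕ, ∀ v w,
      SchreierSupported L α v → SchreierSupported L α w → ∀ n,
      (supScale n v w → t (g n) (Φ v) (Φ w)) ∧ (t n (Φ v) (Φ w) → supScale (g n) v w)) :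
    ∃ Ψ : (ℕ →₀ ℤ) → ℕ, ScaleControlled (fun n (a b : ℕ →₀ ℤ) => supScale n a b) t g Ψ := by
  obtain ⟨x, hsurj, hx⟩ := exists_enumeration_finsupp
  suffices hwf : ¬ WellFounded (ExtendsGood (PairConstraint t g x)) by
    obtain ⟨u, hu⟩ := exists_branch_of_not_wellFounded hwf
    refine ⟨fun a => u (Function.surjInv hsurj a), fun a b n => ?_⟩
    have hab := hu (Function.surjInv hsurj a) (Function.surjInv hsurj b) n
    rwa [Function.surjInv_eq hsurj, Function.surjInv_eq hsurj] at hab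
  intro hwf
  have : IsWellFounded (List ℕ) (ExtendsGood (PairConstraint t g x)) := ⟨hwf⟩
  -- The order is taken beyond the successor of the rank of the empty list.
  obtain ⟨α, hγ, hα, Φ, hΦ⟩ := h _ ((Cardinal.isSuccLimit_omega 1).succ_lt
    (IsWellFounded.rank_lt_omega_one (ExtendsGood (PairConstraint t g x)) []))
  have hle := (largeAt_schreierSubset L hα 1).le_rank_valuesAlong hx hΦ List.nodup_nil
  exact absurd (Order.succ_le_iff.1 hγ) (not_lt.2 hle)

end Tree

theorem theoremB (hMA : MartinsAxiom) (hCH : ¬ ContinuumHypothesis)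
    (L : LadderSystem) (M : Type u) [MetricSpace M] [TopologicalSpace.SeparableSpace M]
    (hM : ∀ α < ω₁, CoarselyEmbeds (SchreierSpace L α) M) :
    CoarselyUniversalForSeparable.{u, v} M := by
  classical
  intro X _ _
  rcases isEmpty_or_nonempty X with hX | hX
  · exact ScaleControlled.coarselyEmbeds (f := fun x : X => isEmptyElim x) (g := id)
      fun x => isEmptyElim x
  have hMne : Nonempty M := by
    obtain ⟨f, -⟩ := (hM 0 (Ordinal.omega_pos 1)).exists_scaleControlled
    exact ⟨f (SchreierSupported.toSpace (v := 0) ⟨{1}, .zero 1, fun _ _ => rfl⟩)⟩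
  set p := TopologicalSpace.denseSeq M
  have hp : DenseRange p := TopologicalSpace.denseRange_denseSeq M
  set t : ℕ → ℕ → ℕ → Prop := fun n i j => metricScale M n (p i) (p j)
  have hemb : ∀ α, ∃ h : ℕ → ℕ, α < ω₁ → ∃ f : SchreierSpace L α → ℕ,
      ScaleControlled (metricScale (SchreierSpace L α)) t h f := by
    intro α
    by_cases hα : α < ω₁
    · obtain ⟨f, g, hf⟩ := (hM α hα).exists_scaleControlled
      obtain ⟨f', g', hf'⟩ := hf.exists_denseRange hp
      exact ⟨g', fun _ => ⟨f', hf'⟩⟩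
    · exact ⟨id, fun h => absurd h hα⟩
  choose h hh using hemb
  obtain ⟨g, hg⟩ := hMA.exists_cofinally_dominating hCH h
  obtain ⟨Ψ, hΨ⟩ := exists_scaleControlled_of_cofinally (L := L) (t := t) (g := g) fun γ hγ => by
    obtain ⟨α, hγα, hα, hle⟩ := hg γ hγ
    obtain ⟨f, hf⟩ := hh α hα
    -- The value `0` off the Schreier supported functions is never tested.
    refine ⟨α, hγα, hα, fun v => if hv : SchreierSupported L α v then f hv.toSpace else 0,
      fun v w hv hw n => ?_⟩
    have := hf.mono_modulus hle hv.toSpace hw.toSpace n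
    rw [hv.metricScale_toSpace_iff hw, hv.metricScale_toSpace_iff hw] at this
    simpa only [dif_pos hv, dif_pos hw] using this
  obtain ⟨f, k, hf⟩ := exists_scaleControlled_finsupp X
  refine ScaleControlled.coarselyEmbeds (f := fun z => p (Ψ (f z)))
    (g := fun n => max (g (k n)) (k (g n))) fun y z n => ⟨fun hs => ?_, fun ht => ?_⟩
  · exact metricScale_mono (le_max_left _ _) ((hΨ _ _ _).1 ((hf y z n).1 hs))
  · exact metricScale_mono (le_max_right _ _) ((hf y z _).2 ((hΨ _ _ n).2 ht))
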